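/- Let $g\ge 4$ and $r\ge 3$ be integers. For every finite non-empty simple graph $G$ that is $r$-regular (every node has degree exactly $r$) and has girth (length of a shortest cycle) at least $g$, the maximum cardinality $|\mathcal I(G)|$ of an independent set of $G$ satisfies $$\frac{|\mathcal I(G)|}{|V(G)|}\;\ge\;\frac{1-(r-1)^{-\frac{2}{r-2}}}{2}-\frac{r\,(r-1)^{\lfloor (g-2)/2\rfloor}}{\left(\lfloor (g-2)/2\rfloor+1\right)!}.$$ Equivalently, the infimum of $|\mathcal I(G)|/|V(G)|$ over all such graphs $G$ is at least the right-hand side. -/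

import Mathlib

open scoped Nat

/-! Give the vertices i.i.d. uniform weights and select each vertex none of whose lighter neighbours
is selected. This greedy set is almost surely independent, so its expected size is at most
`G.indepNum`. Cutting the rule off at a fixed depth yields a lower bound for membership
(`rootApprox_le`) that only looks at a ball. When the girth exceeds `2 * d + 2` the branches at a
vertex are disjoint, hence independent, and the expectation is the one on the regular tree, computed
by the recursion `treeProb` (`card_mul_le_indepNum`).

With `n = r - 1`, the recursion has a fixed point `f = (1 - ∫ f) ^ n`. Setting `F = 1 - ∫ f`, this
reads `F' = -F ^ n`, `F 0 = 1`, so `F x = (1 + (n - 1) x) ^ (-1 / (n - 1))`, and `∫ F ^ (n + 1)`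
over the unit interval is the main term. Each level of the recursion adds one integration to the
truncation error, which produces the factorial (`abs_treeProb_sub_le`). -/

namespace GreedyIndep

open SimpleGraph MeasureTheory ProbabilityTheory Set

/-! ### Large girth: branches at a vertex are disjoint -/

section Girth

variable {V : Type*} {G : SimpleGraph V}

/-- Two distinct neighbours of `w` cannot be joined by a short walk avoiding `w`
in a graph of large girth. -/
theorem egirth_le_of_walk {w a b : V} (ha : G.Adj w a) (hb : G.Adj w b) (hab : a ≠ b)
    (p : G.Walk a b) (hp : w ∉ p.support) : G.egirth ≤ (p.length + 2 : ℕ) := by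
  classical
  have hq : w ∉ p.bypass.support := fun h => hp (p.support_bypass_subset_support h)
  have hcyc : (Walk.cons ha (p.bypass.concat hb.symm)).IsCycle := by
    rw [Walk.cons_isCycle_iff]
    refine ⟨(p.bypass_isPath).concat hq hb.symm, ?_⟩
    rw [Walk.edges_concat]
    simp only [List.concat_eq_append, List.mem_append, List.mem_singleton, not_or]
    refine ⟨fun h => hq (Walk.fst_mem_support_of_mem_edges _ h), fun h => ?_⟩
    rw [Sym2.eq_swap, Sym2.eq_iff] at h
    rcases h with h | h
    · exact hab h.1
    · exact hb.ne h.2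
  refine (egirth_le_length hcyc).trans ?_
  have := p.length_bypass_le_length
  simp only [Walk.length_cons, Walk.length_concat]
  exact_mod_cast (by omega)

/-- The vertices reached from `u` by walks of length at most `d` avoiding `w`. -/
def branch (G : SimpleGraph V) (d : ℕ) (u w : V) : Set V :=
  {y | ∃ p : G.Walk u y, w ∉ p.support ∧ p.length ≤ d}

theorem self_mem_branch {d : ℕ} {u w : V} (h : u ≠ w) : u ∈ branch G d u w :=
  ⟨Walk.nil, by simpa using h.symm, by simp⟩

theorem notMem_branch {d : ℕ} {u w : V} : w ∉ branch G d u w := by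
  rintro ⟨p, hp, -⟩
  exact hp p.end_mem_support

theorem branch_subset {d : ℕ} {u w z : V} (hwu : G.Adj u w) (hz : G.Adj u z) (hzw : z ≠ w)
    (hd : ((d + 2 : ℕ) : ℕ∞) < G.egirth) : branch G d z u ⊆ branch G (d + 1) u w := by
  classical
  rintro y ⟨p, hp, hl⟩
  refine ⟨Walk.cons hz p, ?_, by simpa using hl⟩
  rw [Walk.support_cons, List.mem_cons, not_or]
  refine ⟨hwu.ne', fun hw => ?_⟩
  -- A walk from `z` that met `w` would close up through `u` into a cycle of length at most `d + 2`.
  have h1 := egirth_le_of_walk hz hwu hzw (p.takeUntil w hw)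
    (fun h => hp (p.support_takeUntil_subset_support hw h))
  have h2 := p.length_takeUntil_le_length hw
  refine absurd (h1.trans (?_ : _ ≤ ((d + 2 : ℕ) : ℕ∞))) (not_le.2 hd)
  exact_mod_cast (by omega)

/-- A common vertex would join `a` to `b` by a walk of length at most `2 * d` avoiding `w`, hence
give a cycle of length at most `2 * d + 2`. -/
theorem disjoint_branch {d : ℕ} {w a b : V} (ha : G.Adj w a) (hb : G.Adj w b) (hab : a ≠ b)
    (hd : ((2 * d + 2 : ℕ) : ℕ∞) < G.egirth) : Disjoint (branch G d a w) (branch G d b w) := by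
  rw [Set.disjoint_left]
  rintro y ⟨p, hp, hpl⟩ ⟨q, hq, hql⟩
  have h1 := egirth_le_of_walk ha hb hab (p.append q.reverse) (by
    rw [Walk.mem_support_append_iff, Walk.support_reverse, List.mem_reverse]
    tauto)
  refine absurd (h1.trans (?_ : _ ≤ ((2 * d + 2 : ℕ) : ℕ∞))) (not_le.2 hd)
  rw [Walk.length_append, Walk.length_reverse]
  exact_mod_cast (by omega)

end Girth

/-! ### The greedy set and its local truncations -/

section Greedy

variable {V : Type*} [Fintype V] (G : SimpleGraph V)

/-- For weights `U`, the greedy set: a vertex is selected iff no neighbour of smaller weight is. -/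
theorem exists_greedy (U : V → ℝ) :
    ∃ I : Set V, ∀ v, v ∈ I ↔ ∀ z, G.Adj v z → U z < U v → z ∉ I := by
  have wf : WellFounded (fun a b : V => U a < U b) :=
    haveI : IsTrans V (fun a b : V => U a < U b) := ⟨fun _ _ _ => lt_trans⟩
    haveI : Std.Irrefl (fun a b : V => U a < U b) := ⟨fun _ => lt_irrefl _⟩
    Finite.wellFounded_of_trans_of_irrefl _
  refine ⟨{v | wf.fix (C := fun _ => Prop)
    (fun v rec => ∀ z, G.Adj v z → ∀ h : U z < U v, ¬ rec z h) v}, fun v => ?_⟩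
  rw [Set.mem_ofPred_eq, wf.fix_eq]
  rfl

open Classical in
/-- Depth-`d` truncation of the greedy rule at `u` with weight `x`, ignoring the neighbour `w`.
For `b = true` it overestimates greedy membership, for `b = false` it underestimates it. -/
noncomputable def greedyApprox : Bool → ℕ → V → V → ℝ → (V → ℝ) → ℝ
  | b, 0, _, _, _, _ => if b then 1 else 0
  | b, d + 1, u, w, x, U => ∏ z ∈ (G.neighborFinset u).erase w,
      (1 - if U z < x then greedyApprox (!b) d z u (U z) U else 0)

theorem greedyApprox_mem_Icc (b : Bool) (d : ℕ) (u w : V) (x : ℝ) (U : V → ℝ) :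
    greedyApprox G b d u w x U ∈ Icc (0 : ℝ) 1 := by
  induction d generalizing b u w x with
  | zero => cases b <;> simp [greedyApprox]
  | succ d ih =>
    rw [greedyApprox]
    have h : ∀ z, (1 - if U z < x then greedyApprox G (!b) d z u (U z) U else 0)
        ∈ Icc (0 : ℝ) 1 := fun z => by
      have := ih (!b) z u (U z)
      split_ifs
      · exact ⟨by linarith [this.2], by linarith [this.1]⟩
      · simp
    exact ⟨Finset.prod_nonneg fun z _ => (h z).1,
      Finset.prod_le_one (fun z _ => (h z).1) fun z _ => (h z).2⟩

-- Selection of `u` is antitone in the selection of its lighter neighbours, so over- and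
-- underestimates alternate with depth. The neighbour `w` can be ignored because, being heavier, it
-- cannot block `u`.
open Classical in
theorem greedyApprox_bounds {I : Set V} {U : V → ℝ}
    (hI : ∀ v, v ∈ I ↔ ∀ z, G.Adj v z → U z < U v → z ∉ I) (d : ℕ) {u w : V}
    (huw : U u < U w) :
    greedyApprox G false d u w (U u) U ≤ (if u ∈ I then 1 else 0) ∧
      (if u ∈ I then 1 else 0) ≤ greedyApprox G true d u w (U u) U := by
  induction d generalizing u w with
  | zero => constructor <;> by_cases hu : u ∈ I <;> simp [greedyApprox, hu]
  | succ d ih =>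
    have key : ((if u ∈ I then 1 else 0 : ℝ)) = ∏ z ∈ (G.neighborFinset u).erase w,
        (1 - if U z < U u then (if z ∈ I then (1 : ℝ) else 0) else 0) := by
      split_ifs with hu
      · symm
        refine Finset.prod_eq_one fun z hz => ?_
        rw [Finset.mem_erase, mem_neighborFinset] at hz
        split_ifs with h1 h2
        · exact absurd h2 ((hI u).1 hu z hz.2 h1)
        · simp
        · simp
      · symm
        rw [hI u] at hu
        push Not at hu
        obtain ⟨z, hz, hlt, hzI⟩ := hu
        refine Finset.prod_eq_zero (i := z) ?_ (by simp [hlt, hzI])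
        rw [Finset.mem_erase, mem_neighborFinset]
        exact ⟨fun h => by subst h; linarith, hz⟩
    rw [key]
    simp only [greedyApprox]
    constructor
    · refine Finset.prod_le_prod (fun z _ => ?_) fun z _ => ?_
      · have := greedyApprox_mem_Icc G (!false) d z u (U z) U
        split_ifs
        · linarith [this.2]
        · simp
      · rw [Bool.not_false]
        split_ifs with h1 h2
        · have := (ih h1).2; rw [if_pos h2] at this; linarith
        · have := (ih h1).2; rw [if_neg h2] at this; linarith
        · exact le_rfl
    · refine Finset.prod_le_prod (fun z _ => ?_) fun z _ => ?_
      · split_ifs <;> simp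
      · rw [Bool.not_true]
        split_ifs with h1 h2
        · have := (ih h1).1; rw [if_pos h2] at this; linarith
        · have := (ih h1).1; rw [if_neg h2] at this; linarith
        · exact le_rfl

open Classical in
/-- Truncation of the greedy rule at the root `v` with weight `x`, with branches of depth `d`.
It underestimates greedy membership. -/
noncomputable def rootApprox (d : ℕ) (v : V) (x : ℝ) (U : V → ℝ) : ℝ :=
  ∏ z ∈ G.neighborFinset v, (1 - if U z < x then greedyApprox G true d z v (U z) U else 0)

open Classical in
theorem rootApprox_le {I : Set V} {U : V → ℝ}
    (hI : ∀ v, v ∈ I ↔ ∀ z, G.Adj v z → U z < U v → z ∉ I) (d : ℕ) (v : V) :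
    rootApprox G d v (U v) U ≤ if v ∈ I then 1 else 0 := by
  have h : ∀ z, 0 ≤ (1 - if U z < U v then greedyApprox G true d z v (U z) U else 0) ∧
      (1 - if U z < U v then greedyApprox G true d z v (U z) U else 0) ≤ 1 := fun z => by
    have := greedyApprox_mem_Icc G true d z v (U z) U
    split_ifs
    · exact ⟨by linarith [this.2], by linarith [this.1]⟩
    · simp
  split_ifs with hv
  · exact Finset.prod_le_one (fun z _ => (h z).1) fun z _ => (h z).2
  · rw [hI v] at hv
    push Not at hv
    obtain ⟨z, hz, hlt, hzI⟩ := hv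
    refine (Finset.prod_eq_zero (i := z) (by simpa using hz) ?_).le
    -- The overestimate at the selected vertex `z` is forced to equal 1, so its factor vanishes.
    have h1 := (greedyApprox_bounds G hI d hlt).2
    rw [if_pos hzI] at h1
    rw [if_pos hlt, le_antisymm (greedyApprox_mem_Icc G true d z v (U z) U).2 h1, sub_self]

theorem sum_rootApprox_le (d : ℕ) {U : V → ℝ} (hU : Function.Injective U) :
    ∑ v, rootApprox G d v (U v) U ≤ G.indepNum := by
  classical
  obtain ⟨I, hI⟩ := exists_greedy G U
  have hind : G.IsIndepSet (Finset.univ.filter (· ∈ I) : Finset V) := by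
    intro a ha b hb hab hadj
    simp only [Finset.coe_filter, Finset.mem_univ, true_and, Set.mem_ofPred_eq] at ha hb
    rcases lt_trichotomy (U a) (U b) with h | h | h
    · exact (hI b).1 hb a hadj.symm h ha
    · exact hab (hU h)
    · exact (hI a).1 ha b hadj h hb
  calc ∑ v, rootApprox G d v (U v) U ≤ ∑ v, if v ∈ I then (1 : ℝ) else 0 :=
        Finset.sum_le_sum fun v _ => by convert rootApprox_le G hI d v
    _ = ((Finset.univ.filter (· ∈ I)).card : ℝ) := by simp
    _ ≤ G.indepNum := by exact_mod_cast hind.card_le_indepNum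

variable {G}

/-- The weight of `u` enters only through `x`; excluding `u` here is what later allows conditioning
on `U u`. -/
theorem dependsOn_greedyApprox (b : Bool) (d : ℕ) {u w : V} (huw : G.Adj u w) (x : ℝ)
    (hd : ((2 * d + 2 : ℕ) : ℕ∞) < G.egirth) :
    DependsOn (greedyApprox G b d u w x) (branch G d u w \ {u}) := by
  classical
  induction d generalizing b u w x with
  | zero => intro U U' _; simp [greedyApprox]
  | succ d ih =>
    intro U U' h
    have hd' : ((2 * d + 2 : ℕ) : ℕ∞) < G.egirth := lt_of_le_of_lt (by exact_mod_cast (by omega)) hd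
    have hd'' : ((d + 2 : ℕ) : ℕ∞) < G.egirth := lt_of_le_of_lt (by exact_mod_cast (by omega)) hd
    simp only [greedyApprox]
    refine Finset.prod_congr rfl fun z hz => ?_
    rw [Finset.mem_erase, mem_neighborFinset] at hz
    have hsub : ∀ i ∈ branch G d z u, U i = U' i := fun i hi =>
      h i ⟨branch_subset huw hz.2 hz.1 hd'' hi, fun hiu => by
        rw [Set.mem_singleton_iff] at hiu
        subst hiu
        exact notMem_branch hi⟩
    rw [hsub z (self_mem_branch hz.2.ne'),
      ih (!b) hz.2.symm (U' z) hd' (fun i hi => hsub i hi.1)]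

theorem dependsOn_greedyFactor (b : Bool) (d : ℕ) {u w : V} (huw : G.Adj u w) (x : ℝ)
    (hd : ((2 * d + 2 : ℕ) : ℕ∞) < G.egirth) :
    DependsOn (fun U => 1 - if U u < x then greedyApprox G b d u w (U u) U else 0)
      (branch G d u w) := by
  intro U U' h
  simp only
  rw [h u (self_mem_branch huw.ne),
    dependsOn_greedyApprox b d huw (U' u) hd (fun i hi => h i hi.1)]

variable (G)

theorem measurable_greedyApprox (b : Bool) (d : ℕ) (u w : V) :
    Measurable fun p : ℝ × (V → ℝ) => greedyApprox G b d u w p.1 p.2 := by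
  induction d generalizing b u w with
  | zero => simp [greedyApprox]
  | succ d ih =>
    simp only [greedyApprox]
    refine Finset.measurable_prod _ fun z _ => measurable_const.sub ?_
    refine Measurable.ite (measurableSet_lt (by fun_prop) (by fun_prop)) ?_ measurable_const
    exact (ih (!b) z u).comp (by fun_prop : Measurable fun p : ℝ × (V → ℝ) => (p.2 z, p.2))

theorem measurable_greedyFactor (b : Bool) (d : ℕ) (u w : V) :
    Measurable fun p : ℝ × (V → ℝ) =>
      1 - if p.2 u < p.1 then greedyApprox G b d u w (p.2 u) p.2 else 0 := by
  refine measurable_const.sub ?_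
  refine Measurable.ite (measurableSet_lt (by fun_prop) (by fun_prop)) ?_ measurable_const
  exact (measurable_greedyApprox G b d u w).comp
    (by fun_prop : Measurable fun p : ℝ × (V → ℝ) => (p.2 u, p.2))

theorem measurable_rootApprox (d : ℕ) (v : V) :
    Measurable fun p : ℝ × (V → ℝ) => rootApprox G d v p.1 p.2 :=
  Finset.measurable_prod _ fun z _ => measurable_greedyFactor G true d z v

end Greedy

/-! ### Independence of functions of disjoint sets of coordinates -/

section Product

variable {V : Type*}

open Classical in
/-- Extend a partial assignment of weights by zero. -/
noncomputable def extendZero (S : Finset V) (z : S → ℝ) : V → ℝ :=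
  fun i => if h : i ∈ S then z ⟨i, h⟩ else 0

theorem measurable_extendZero (S : Finset V) : Measurable (extendZero S) := by
  refine measurable_pi_lambda _ fun i => ?_
  by_cases h : i ∈ S
  · simpa [extendZero, h] using measurable_pi_apply _
  · simp [extendZero, h]

theorem DependsOn.extendZero_eq {F : (V → ℝ) → ℝ} {S : Finset V} (hF : DependsOn F (S : Set V))
    (U : V → ℝ) : F (extendZero S fun i => U i) = F U :=
  hF fun i hi => by simp [extendZero, Finset.mem_coe.1 hi]

variable [Fintype V] (ν : Measure ℝ) [IsProbabilityMeasure ν]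

theorem indepFun_restrict {S T : Finset V} (h : Disjoint S T) :
    IndepFun (fun (U : V → ℝ) (i : S) => U i) (fun (U : V → ℝ) (i : T) => U i)
      (Measure.pi fun _ : V => ν) :=
  (iIndepFun_pi (μ := fun _ : V => ν) (X := fun _ => id)
    fun _ => aemeasurable_id).indepFun_finset S T h fun i => measurable_pi_apply i

theorem integral_mul_of_dependsOn {F H : (V → ℝ) → ℝ} {S T : Set V} (hF : DependsOn F S)
    (hH : DependsOn H T) (hFm : Measurable F) (hHm : Measurable H) (h : Disjoint S T) :
    ∫ U, F U * H U ∂(Measure.pi fun _ : V => ν) =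
      (∫ U, F U ∂(Measure.pi fun _ : V => ν)) * ∫ U, H U ∂(Measure.pi fun _ : V => ν) := by
  classical
  rw [← S.coe_toFinset] at hF
  rw [← T.coe_toFinset] at hH
  have hind := indepFun_restrict ν (Set.disjoint_toFinset.2 h)
  have := hind.integral_fun_comp_mul_comp (f := fun z => F (extendZero _ z))
    (g := fun z => H (extendZero _ z))
    (measurable_pi_lambda _ fun i => measurable_pi_apply _).aemeasurable
    (measurable_pi_lambda _ fun i => measurable_pi_apply _).aemeasurable
    (hFm.comp (measurable_extendZero _)).aestronglyMeasurable
    (hHm.comp (measurable_extendZero _)).aestronglyMeasurable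
  simpa only [DependsOn.extendZero_eq hF, DependsOn.extendZero_eq hH] using this

theorem integral_prod_of_dependsOn {ι : Type*} (s : Finset ι) {F : ι → (V → ℝ) → ℝ}
    {T : ι → Set V} (hF : ∀ i ∈ s, DependsOn (F i) (T i)) (hm : ∀ i ∈ s, Measurable (F i))
    (hT : (s : Set ι).PairwiseDisjoint T) :
    ∫ U, ∏ i ∈ s, F i U ∂(Measure.pi fun _ : V => ν) =
      ∏ i ∈ s, ∫ U, F i U ∂(Measure.pi fun _ : V => ν) := by
  classical
  induction s using Finset.induction_on with
  | empty => simp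
  | insert a s ha ih =>
    simp only [Finset.prod_insert ha]
    rw [← ih (fun i hi => hF i (Finset.mem_insert_of_mem hi))
      (fun i hi => hm i (Finset.mem_insert_of_mem hi))
      (hT.subset (by simp))]
    refine integral_mul_of_dependsOn (S := T a) (T := ⋃ i ∈ s, T i) ν
      (hF a (Finset.mem_insert_self a s)) ?_ (hm a (Finset.mem_insert_self a s)) ?_ ?_
    · intro U U' h
      refine Finset.prod_congr rfl fun i hi => hF i (Finset.mem_insert_of_mem hi) fun j hj => ?_
      exact h j (Set.mem_biUnion (Finset.mem_coe.2 hi) hj)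
    · exact Finset.measurable_prod _ fun i hi => hm i (Finset.mem_insert_of_mem hi)
    · rw [Set.disjoint_iUnion₂_right]
      intro i hi
      exact hT (by simp) (by simp [hi]) (fun h => ha (h ▸ hi))

/-- Integrating out the weight of `u` last, when the other argument does not depend on it. -/
theorem integral_eval_of_dependsOn {H : ℝ → (V → ℝ) → ℝ} {u : V} {S : Set V}
    (hH : ∀ x, DependsOn (H x) S) (hm : Measurable fun p : ℝ × (V → ℝ) => H p.1 p.2)
    (hb : ∀ x U, |H x U| ≤ 1) (hu : u ∉ S) :
    ∫ U, H (U u) U ∂(Measure.pi fun _ : V => ν) =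
      ∫ x, ∫ U, H x U ∂(Measure.pi fun _ : V => ν) ∂ν := by
  classical
  rw [← S.coe_toFinset] at hH
  have hd : Disjoint ({u} : Finset V) S.toFinset := by simpa using hu
  set X : (V → ℝ) → ℝ := fun U => U u with hX
  set Y : (V → ℝ) → (S.toFinset → ℝ) := fun U i => U i with hY
  have hXm : Measurable X := by fun_prop
  have hYm : Measurable Y := by fun_prop
  have hind : IndepFun X Y (Measure.pi fun _ : V => ν) :=
    (indepFun_restrict ν hd).comp (measurable_pi_apply (⟨u, Finset.mem_singleton_self u⟩ : ({u} : Finset V))) measurable_id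
  have hmap := (indepFun_iff_map_prod_eq_prod_map_map hXm.aemeasurable hYm.aemeasurable).1 hind
  have hXlaw : (Measure.pi fun _ : V => ν).map X = ν :=
    (measurePreserving_eval (fun _ : V => ν) u).map_eq
  rw [hXlaw] at hmap
  have hGm : Measurable fun p : ℝ × (S.toFinset → ℝ) => H p.1 (extendZero _ p.2) :=
    hm.comp (measurable_fst.prodMk ((measurable_extendZero _).comp measurable_snd))
  have : IsProbabilityMeasure ((Measure.pi fun _ : V => ν).map Y) :=
    Measure.isProbabilityMeasure_map hYm.aemeasurable
  calc ∫ U, H (U u) U ∂(Measure.pi fun _ : V => ν)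
      = ∫ U, H (X U) (extendZero _ (Y U)) ∂(Measure.pi fun _ : V => ν) := by
        simp only [hX, hY, DependsOn.extendZero_eq (hH _)]
    _ = ∫ p, H p.1 (extendZero _ p.2) ∂(ν.prod ((Measure.pi fun _ : V => ν).map Y)) := by
        rw [← hmap, integral_map (hXm.prodMk hYm).aemeasurable hGm.aestronglyMeasurable]
    _ = ∫ x, ∫ z, H x (extendZero _ z) ∂((Measure.pi fun _ : V => ν).map Y) ∂ν := by
        refine integral_prod _ (Integrable.of_bound hGm.aestronglyMeasurable 1 ?_)
        exact Filter.Eventually.of_forall fun p => hb _ _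
    _ = ∫ x, ∫ U, H x U ∂(Measure.pi fun _ : V => ν) ∂ν := by
        refine integral_congr_ae (Filter.Eventually.of_forall fun x => ?_)
        simp only
        have hGx : Measurable fun z => H x (extendZero S.toFinset z) :=
          hGm.comp (measurable_const.prodMk measurable_id)
        rw [integral_map hYm.aemeasurable hGx.aestronglyMeasurable]
        simp only [hY, DependsOn.extendZero_eq (hH _)]

end Product

/-! ### Uniform weights -/

section Uniform

/-- The uniform measure on the unit interval. -/
noncomputable abbrev unif : Measure ℝ := volume.restrict (Ioo 0 1)

instance : IsProbabilityMeasure unif := ⟨by simp⟩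

theorem integral_unif (f : ℝ → ℝ) : ∫ x, f x ∂unif = ∫ x in (0 : ℝ)..1, f x := by
  rw [intervalIntegral.integral_of_le zero_le_one, integral_Ioc_eq_integral_Ioo]

theorem integral_unif_ite_lt (f : ℝ → ℝ) {x : ℝ} (h0 : 0 ≤ x) (h1 : x ≤ 1) :
    ∫ y, (if y < x then f y else 0) ∂unif = ∫ y in (0 : ℝ)..x, f y := by
  have : (fun y => if y < x then f y else 0) = (Iio x).indicator f := by
    ext y; simp [indicator_apply]
  rw [this, integral_indicator measurableSet_Iio, Measure.restrict_restrict measurableSet_Iio,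
    intervalIntegral.integral_of_le h0, integral_Ioc_eq_integral_Ioo]
  congr 2
  ext y
  simp only [mem_inter_iff, mem_Iio, mem_Ioo]
  constructor
  · rintro ⟨h, h', -⟩; exact ⟨h', h⟩
  · rintro ⟨h, h'⟩; exact ⟨h', h, by linarith⟩

/-- Ties lie in finitely many hyperplanes `U i = U j`, which are null. -/
theorem ae_injective_unif (V : Type*) [Fintype V] :
    ∀ᵐ U ∂(Measure.pi fun _ : V => unif), Function.Injective U := by
  have hac : (Measure.pi fun _ : V => unif) ≪ (volume : Measure (V → ℝ)) := by
    rw [volume_pi, ← Measure.restrict_pi_pi]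
    exact Measure.restrict_le_self.absolutelyContinuous
  refine hac.ae_le ?_
  have h : ∀ i j : V, i ≠ j → ∀ᵐ U : V → ℝ, U i ≠ U j := by
    classical
    intro i j hij
    have := Measure.addHaar_submodule (volume : Measure (V → ℝ))
      (LinearMap.ker ((LinearMap.proj i : (V → ℝ) →ₗ[ℝ] ℝ) - LinearMap.proj j)) (by
        rw [Ne, Submodule.eq_top_iff']
        intro h
        have := h (Pi.single i 1)
        simp [hij.symm] at this)
    rw [ae_iff]
    convert this using 2
    ext U
    simp [sub_eq_zero]
  filter_upwards [ae_all_iff.2 fun i => ae_all_iff.2 fun j =>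
    (ae_all_iff.2 (h i j) : ∀ᵐ U : V → ℝ, ∀ _ : i ≠ j, U i ≠ U j)] with U hU i j hij
  by_contra hne
  exact hU i j hne hij

end Uniform

/-! ### Expectation of the truncated rule via the tree recursion -/

section Expectation

variable {V : Type*} [Fintype V] {G : SimpleGraph V}

/-- The expectation of the truncated greedy rule on the tree with branching number `n`. -/
noncomputable def treeProb (n : ℕ) : Bool → ℕ → ℝ → ℝ
  | b, 0, _ => if b then 1 else 0
  | b, d + 1, x => (1 - ∫ y in (0 : ℝ)..x, treeProb n (!b) d y) ^ n

variable (G) in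
theorem abs_rootApprox_le_one (d : ℕ) (v : V) (x : ℝ) (U : V → ℝ) :
    |rootApprox G d v x U| ≤ 1 := by
  rw [rootApprox, Finset.abs_prod]
  refine Finset.prod_le_one (fun z _ => abs_nonneg _) fun z _ => ?_
  have := greedyApprox_mem_Icc G true d z v (U z) U
  split_ifs
  · rw [abs_le]; constructor <;> linarith [this.1, this.2]
  · simp

theorem integral_prod_greedyFactor (b : Bool) (d n : ℕ) {u : V} (s : Finset V)
    (hs : ∀ z ∈ s, G.Adj z u) (hd : ((2 * d + 2 : ℕ) : ℕ∞) < G.egirth)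
    (ih : ∀ z ∈ s, ∀ y ∈ Icc (0 : ℝ) 1,
      ∫ U, greedyApprox G b d z u y U ∂(Measure.pi fun _ : V => unif) = treeProb n b d y)
    {x : ℝ} (hx : x ∈ Icc (0 : ℝ) 1) :
    ∫ U, ∏ z ∈ s, (1 - if U z < x then greedyApprox G b d z u (U z) U else 0)
      ∂(Measure.pi fun _ : V => unif) = (1 - ∫ y in (0 : ℝ)..x, treeProb n b d y) ^ s.card := by
  rw [integral_prod_of_dependsOn unif s (T := fun z => branch G d z u)
    (fun z hz => dependsOn_greedyFactor b d (hs z hz) x hd)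
    (fun z _ => (measurable_greedyFactor G b d z u).comp
      (by fun_prop : Measurable fun U : V → ℝ => (x, U)))
    (fun z hz z' hz' hne => disjoint_branch (hs z hz).symm (hs z' hz').symm hne hd)]
  refine Finset.prod_eq_pow_card fun z hz => ?_
  have hm : Measurable fun p : ℝ × (V → ℝ) =>
      if p.1 < x then greedyApprox G b d z u p.1 p.2 else 0 :=
    Measurable.ite (measurableSet_lt measurable_fst measurable_const)
      (measurable_greedyApprox G b d z u) measurable_const
  have hb : ∀ (y : ℝ) (U : V → ℝ), |if y < x then greedyApprox G b d z u y U else 0| ≤ 1 := by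
    intro y U
    have := greedyApprox_mem_Icc G b d z u y U
    split_ifs
    · rw [abs_of_nonneg this.1]; exact this.2
    · simp
  have hm' : Measurable fun U : V → ℝ => if U z < x then greedyApprox G b d z u (U z) U else 0 :=
    hm.comp (by fun_prop : Measurable fun U : V → ℝ => (U z, U))
  have hi : Integrable (fun U : V → ℝ => if U z < x then greedyApprox G b d z u (U z) U else 0)
      (Measure.pi fun _ : V => unif) :=
    Integrable.of_bound (C := 1) hm'.aestronglyMeasurable (Filter.Eventually.of_forall fun U => hb _ _)
  rw [integral_sub (integrable_const _) hi, integral_const, probReal_univ, one_smul]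
  congr 1
  -- Condition on the weight `y` of `z`: given `y`, the rest of the branch has mean `treeProb n b d
  -- y`.
  rw [integral_eval_of_dependsOn unif
    (H := fun y U => if y < x then greedyApprox G b d z u y U else 0)
    (S := branch G d z u \ {z}) (fun y U U' h => ?_) hm hb (by simp)]
  · rw [← integral_unif_ite_lt _ hx.1 hx.2]
    refine setIntegral_congr_fun measurableSet_Ioo fun y hy => ?_
    split_ifs with h
    · exact ih z hz y ⟨hy.1.le, hy.2.le⟩
    · simp
  · simp only
    rw [dependsOn_greedyApprox b d (hs z hz) y hd h]

theorem integral_greedyApprox [DecidableRel G.Adj] {n : ℕ} (hreg : G.IsRegularOfDegree (n + 1))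
    (b : Bool) (d : ℕ) {u w : V} (huw : G.Adj u w) (hd : ((2 * d + 2 : ℕ) : ℕ∞) < G.egirth)
    {x : ℝ} (hx : x ∈ Icc (0 : ℝ) 1) :
    ∫ U, greedyApprox G b d u w x U ∂(Measure.pi fun _ : V => unif) = treeProb n b d x := by
  classical
  induction d generalizing b u w x with
  | zero => simp [greedyApprox, treeProb]
  | succ d ih =>
    have hd' : ((2 * d + 2 : ℕ) : ℕ∞) < G.egirth := lt_of_le_of_lt (by exact_mod_cast (by omega)) hd
    simp only [greedyApprox, treeProb]
    rw [integral_prod_greedyFactor (!b) d n _ (fun z hz => ?_) hd' (fun z hz y hy => ?_) hx]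
    · congr 1
      rw [Finset.card_erase_of_mem (by simpa using huw)]
      have := hreg u
      simp only [← card_neighborFinset_eq_degree] at this
      convert Nat.add_sub_cancel (n := n) (m := 1)
      convert this
    · simp only [Finset.mem_erase, mem_neighborFinset] at hz
      exact hz.2.symm
    · simp only [Finset.mem_erase, mem_neighborFinset] at hz
      exact ih (!b) hz.2.symm hd' hy

/-- The root has no excluded neighbour, hence the exponent `n + 1` where the recursion has `n`. -/
theorem integral_rootApprox [DecidableRel G.Adj] {n : ℕ} (hreg : G.IsRegularOfDegree (n + 1))
    (d : ℕ) (v : V) (hd : ((2 * d + 2 : ℕ) : ℕ∞) < G.egirth) :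
    ∫ U, rootApprox G d v (U v) U ∂(Measure.pi fun _ : V => unif) =
      ∫ x in (0 : ℝ)..1, (1 - ∫ y in (0 : ℝ)..x, treeProb n true d y) ^ (n + 1) := by
  classical
  have hadj : ∀ z ∈ G.neighborFinset v, G.Adj z v := fun z hz => by
    rw [mem_neighborFinset] at hz; exact hz.symm
  rw [integral_eval_of_dependsOn unif (H := rootApprox G d v) (S := {v}ᶜ)
    (fun x U U' h => ?_) (measurable_rootApprox G d v) (fun x U => ?_) (by simp), ← integral_unif]
  · refine setIntegral_congr_fun measurableSet_Ioo fun x hx => ?_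
    simp only [rootApprox]
    rw [integral_prod_greedyFactor true d n _ (fun z hz => hadj z (by convert hz)) hd
      (fun z hz y hy => integral_greedyApprox hreg true d (hadj z (by convert hz)) hd hy)
      ⟨hx.1.le, hx.2.le⟩]
    congr 1
    rw [← hreg v, ← card_neighborFinset_eq_degree]
    congr!
  · refine Finset.prod_congr rfl fun z hz => ?_
    refine dependsOn_greedyFactor true d (hadj z (by convert hz)) x hd fun i hi => h i fun hiv => ?_
    rw [Set.mem_singleton_iff] at hiv
    subst hiv
    exact notMem_branch hi
  · exact abs_rootApprox_le_one G d v x U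

theorem card_mul_le_indepNum [DecidableRel G.Adj] {n : ℕ} (hreg : G.IsRegularOfDegree (n + 1))
    (d : ℕ) (hd : ((2 * d + 2 : ℕ) : ℕ∞) < G.egirth) :
    Fintype.card V * ∫ x in (0 : ℝ)..1, (1 - ∫ y in (0 : ℝ)..x, treeProb n true d y) ^ (n + 1)
      ≤ G.indepNum := by
  have hint : ∀ v, Integrable (fun U => rootApprox G d v (U v) U)
      (Measure.pi fun _ : V => unif) := fun v => by
    have hm : Measurable fun U : V → ℝ => rootApprox G d v (U v) U :=
      (measurable_rootApprox G d v).comp (by fun_prop : Measurable fun U : V → ℝ => (U v, U))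
    exact Integrable.of_bound (C := 1) hm.aestronglyMeasurable
      (Filter.Eventually.of_forall fun U => abs_rootApprox_le_one G d v (U v) U)
  calc (Fintype.card V : ℝ) * ∫ x in (0 : ℝ)..1,
        (1 - ∫ y in (0 : ℝ)..x, treeProb n true d y) ^ (n + 1)
      = ∑ v, ∫ U, rootApprox G d v (U v) U ∂(Measure.pi fun _ : V => unif) := by
        simp [integral_rootApprox hreg d _ hd]
    _ = ∫ U, ∑ v, rootApprox G d v (U v) U ∂(Measure.pi fun _ : V => unif) :=
        (integral_finsetSum _ fun v _ => hint v).symm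
    _ ≤ ∫ _, (G.indepNum : ℝ) ∂(Measure.pi fun _ : V => unif) := by
        refine integral_mono_ae (integrable_finsetSum _ fun v _ => hint v)
          (integrable_const _) ?_
        filter_upwards [ae_injective_unif V] with U hU
        exact sum_rootApprox_le G d hU
    _ = G.indepNum := by simp

end Expectation

/-! ### Truncation error and the explicit fixed point -/

section Analysis

theorem continuous_treeProb (n : ℕ) (b : Bool) (d : ℕ) : Continuous (treeProb n b d) := by
  induction d generalizing b with
  | zero => exact continuous_const
  | succ d ih =>
    exact (continuous_const.sub
      (intervalIntegral.continuous_primitive (fun _ _ => (ih _).intervalIntegrable _ _) 0)).pow n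

theorem integral_mem_Icc_of_mem_Icc {f : ℝ → ℝ} (hf : Continuous f)
    (h : ∀ x ∈ Icc (0 : ℝ) 1, f x ∈ Icc (0 : ℝ) 1) {x : ℝ} (hx : x ∈ Icc (0 : ℝ) 1) :
    ∫ y in (0 : ℝ)..x, f y ∈ Icc (0 : ℝ) 1 := by
  refine ⟨intervalIntegral.integral_nonneg hx.1 fun y hy => (h y ⟨hy.1, hy.2.trans hx.2⟩).1, ?_⟩
  calc ∫ y in (0 : ℝ)..x, f y ≤ ∫ _ in (0 : ℝ)..x, (1 : ℝ) :=
        intervalIntegral.integral_mono_on hx.1 (hf.intervalIntegrable _ _) (by simp)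
          fun y hy => (h y ⟨hy.1, hy.2.trans hx.2⟩).2
    _ ≤ 1 := by simpa using hx.2

theorem treeProb_mem_Icc (n : ℕ) (b : Bool) (d : ℕ) {x : ℝ} (hx : x ∈ Icc (0 : ℝ) 1) :
    treeProb n b d x ∈ Icc (0 : ℝ) 1 := by
  induction d generalizing b x with
  | zero => cases b <;> simp [treeProb]
  | succ d ih =>
    have := integral_mem_Icc_of_mem_Icc (continuous_treeProb n (!b) d) (fun y hy => ih (!b) hy) hx
    exact ⟨pow_nonneg (by linarith [this.2]) _,
      pow_le_one₀ (by linarith [this.2]) (by linarith [this.1])⟩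

theorem abs_pow_sub_pow_le_of_mem_Icc (n : ℕ) {a b : ℝ} (ha : a ∈ Icc (0 : ℝ) 1)
    (hb : b ∈ Icc (0 : ℝ) 1) : |a ^ n - b ^ n| ≤ n * |a - b| := by
  refine (abs_pow_sub_pow_le (α := ℝ) ..).trans ?_
  rw [abs_of_nonneg ha.1, abs_of_nonneg hb.1, mul_comm |a - b|]
  exact mul_le_of_le_one_right (by positivity)
    (pow_le_one₀ (le_max_of_le_left ha.1) (max_le ha.2 hb.2))

/-- If `f` is a fixed point of the tree recursion, the depth-`d` truncation is close to it. -/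
theorem abs_treeProb_sub_le (n : ℕ) {f : ℝ → ℝ} (hc : Continuous f)
    (hf : ∀ x ∈ Icc (0 : ℝ) 1, f x ∈ Icc (0 : ℝ) 1)
    (hfix : ∀ x ∈ Icc (0 : ℝ) 1, f x = (1 - ∫ y in (0 : ℝ)..x, f y) ^ n)
    (b : Bool) (d : ℕ) {x : ℝ} (hx : x ∈ Icc (0 : ℝ) 1) :
    |treeProb n b d x - f x| ≤ n ^ d * x ^ d / d ! ∧
      |(1 - ∫ y in (0 : ℝ)..x, treeProb n b d y) - (1 - ∫ y in (0 : ℝ)..x, f y)|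
        ≤ n ^ d * x ^ (d + 1) / (d + 1)! := by
  -- Integrating an error of order `y ^ d / d !` gains the next factor of the factorial; the `n`-th
  -- power then costs a Lipschitz factor `n`.
  have step : ∀ (b : Bool) (d : ℕ), (∀ y ∈ Icc (0 : ℝ) 1,
      |treeProb n b d y - f y| ≤ n ^ d * y ^ d / d !) → ∀ x ∈ Icc (0 : ℝ) 1,
      |(1 - ∫ y in (0 : ℝ)..x, treeProb n b d y) - (1 - ∫ y in (0 : ℝ)..x, f y)|
        ≤ n ^ d * x ^ (d + 1) / (d + 1)! := by
    intro b d h x hx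
    have hT := continuous_treeProb n b d
    rw [sub_sub_sub_cancel_left, abs_sub_comm, ← intervalIntegral.integral_sub
      (hT.intervalIntegrable _ _) (hc.intervalIntegrable _ _)]
    calc |∫ y in (0 : ℝ)..x, (treeProb n b d y - f y)|
        ≤ ∫ y in (0 : ℝ)..x, |treeProb n b d y - f y| :=
          intervalIntegral.abs_integral_le_integral_abs hx.1
      _ ≤ ∫ y in (0 : ℝ)..x, (n ^ d / d ! : ℝ) * y ^ d :=
          intervalIntegral.integral_mono_on hx.1 ((hT.sub hc).abs.intervalIntegrable _ _)
            ((by fun_prop : Continuous fun y : ℝ => (n ^ d / d ! : ℝ) * y ^ d).intervalIntegrable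
              _ _) fun y hy => (h y ⟨hy.1, hy.2.trans hx.2⟩).trans_eq (by ring)
      _ = n ^ d * x ^ (d + 1) / (d + 1)! := by
          rw [intervalIntegral.integral_const_mul, integral_pow, Nat.factorial_succ]
          push_cast
          field_simp
          simp
  have main : ∀ (d : ℕ) (b : Bool), ∀ x ∈ Icc (0 : ℝ) 1,
      |treeProb n b d x - f x| ≤ n ^ d * x ^ d / d ! := by
    intro d
    induction d with
    | zero =>
      intro b x hx
      have h1 := treeProb_mem_Icc n b 0 hx
      have h2 := hf x hx
      simp only [pow_zero, mul_one, Nat.factorial_zero, Nat.cast_one, div_one]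
      rw [abs_le]
      constructor <;> linarith [h1.1, h1.2, h2.1, h2.2]
    | succ d ih =>
      intro b x hx
      have h1 := integral_mem_Icc_of_mem_Icc (continuous_treeProb n (!b) d)
        (fun y hy => treeProb_mem_Icc n (!b) d hy) hx
      have h2 := integral_mem_Icc_of_mem_Icc hc hf hx
      rw [hfix x hx, treeProb]
      refine (abs_pow_sub_pow_le_of_mem_Icc n ⟨by linarith [h1.2], by linarith [h1.1]⟩
        ⟨by linarith [h2.2], by linarith [h2.1]⟩).trans ?_
      refine (mul_le_mul_of_nonneg_left (step (!b) d (ih (!b)) x hx) (by positivity)).trans_eq ?_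
      ring
  exact ⟨main d b x hx, step b d (main d b) x hx⟩

theorem integral_treeProb_ge (n : ℕ) {f : ℝ → ℝ} (hc : Continuous f)
    (hf : ∀ x ∈ Icc (0 : ℝ) 1, f x ∈ Icc (0 : ℝ) 1)
    (hfix : ∀ x ∈ Icc (0 : ℝ) 1, f x = (1 - ∫ y in (0 : ℝ)..x, f y) ^ n) (b : Bool) (d m : ℕ) :
    (∫ x in (0 : ℝ)..1, (1 - ∫ y in (0 : ℝ)..x, f y) ^ m) - m * n ^ d / (d + 2)! ≤
      ∫ x in (0 : ℝ)..1, (1 - ∫ y in (0 : ℝ)..x, treeProb n b d y) ^ m := by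
  have hcont : ∀ {h : ℝ → ℝ}, Continuous h →
      Continuous fun x => (1 - ∫ y in (0 : ℝ)..x, h y) ^ m := fun hh =>
    (continuous_const.sub (intervalIntegral.continuous_primitive
      (fun _ _ => hh.intervalIntegrable _ _) 0)).pow m
  have hT := continuous_treeProb n b d
  have hP : Continuous fun x : ℝ => (m * n ^ d / (d + 1)! : ℝ) * x ^ (d + 1) := by fun_prop
  have hval : ∫ x in (0 : ℝ)..1, (m * n ^ d / (d + 1)! : ℝ) * x ^ (d + 1)
      = m * n ^ d / (d + 2)! := by
    rw [intervalIntegral.integral_const_mul, integral_pow, Nat.factorial_succ (d + 1)]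
    push_cast
    field_simp
    simp
  rw [← hval, ← intervalIntegral.integral_sub ((hcont hc).intervalIntegrable _ _)
    (hP.intervalIntegrable _ _)]
  refine intervalIntegral.integral_mono_on zero_le_one
    (((hcont hc).sub hP).intervalIntegrable _ _) ((hcont hT).intervalIntegrable _ _) fun x hx => ?_
  have h1 := integral_mem_Icc_of_mem_Icc hT (fun y hy => treeProb_mem_Icc n b d hy) hx
  have h2 := integral_mem_Icc_of_mem_Icc hc hf hx
  have h3 := abs_pow_sub_pow_le_of_mem_Icc m
    (a := 1 - ∫ y in (0 : ℝ)..x, treeProb n b d y) (b := 1 - ∫ y in (0 : ℝ)..x, f y)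
    ⟨by linarith [h1.2], by linarith [h1.1]⟩ ⟨by linarith [h2.2], by linarith [h2.1]⟩
  have h4 := mul_le_mul_of_nonneg_left (abs_treeProb_sub_le n hc hf hfix b d hx).2
    (Nat.cast_nonneg (α := ℝ) m)
  have h5 := (neg_abs_le _).trans' (neg_le_neg (h3.trans h4))
  have h6 : (m * n ^ d / (d + 1)! : ℝ) * x ^ (d + 1) = m * (n ^ d * x ^ (d + 1) / (d + 1)!) := by
    ring
  rw [h6]
  linarith

/-- The antiderivative of `(1 + a x) ^ (-(s + 1))`, up to a constant factor. -/
theorem integral_one_add_mul_rpow {a s : ℝ} (ha : 0 < a) (hs : 0 < s) {x : ℝ} (hx : 0 ≤ x) :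
    ∫ y in (0 : ℝ)..x, (1 + a * |y|) ^ (-s - 1) = (1 - (1 + a * x) ^ (-s)) / (a * s) := by
  have h : ∀ y ∈ uIcc 0 x, HasDerivAt (fun y => -(1 + a * y) ^ (-s) / (a * s))
      ((1 + a * y) ^ (-s - 1)) y := by
    intro y hy
    rw [uIcc_of_le hx] at hy
    have hpos : 0 < 1 + a * y := by have := mul_nonneg ha.le hy.1; linarith
    have h1 : HasDerivAt (fun y => 1 + a * y) a y := by
      simpa using ((hasDerivAt_id y).const_mul a).const_add 1
    have h2 := ((h1.rpow_const (p := -s) (Or.inl hpos.ne')).neg).div_const (a * s)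
    refine h2.congr_deriv ?_
    field_simp
  have hcongr : ∫ y in (0 : ℝ)..x, (1 + a * |y|) ^ (-s - 1) =
      ∫ y in (0 : ℝ)..x, (1 + a * y) ^ (-s - 1) := by
    refine intervalIntegral.integral_congr fun y hy => ?_
    rw [uIcc_of_le hx] at hy
    simp only [abs_of_nonneg hy.1]
  rw [hcongr, intervalIntegral.integral_eq_sub_of_hasDerivAt h]
  · simp only [mul_zero, add_zero, Real.one_rpow]
    ring
  · refine ContinuousOn.intervalIntegrable fun y hy => ?_
    rw [uIcc_of_le hx] at hy
    have hpos : 0 < 1 + a * y := by have := mul_nonneg ha.le hy.1; linarith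
    exact ((by fun_prop : ContinuousAt (fun y => 1 + a * y) y).rpow_const
      (Or.inl hpos.ne')).continuousWithinAt

theorem integral_treeProb_ge_explicit {n : ℕ} (hn : 2 ≤ n) (b : Bool) (d : ℕ) :
    (1 - (n : ℝ) ^ (-(2 / ((n : ℝ) - 1)))) / 2 - (n + 1) * n ^ d / (d + 2)! ≤
      ∫ x in (0 : ℝ)..1, (1 - ∫ y in (0 : ℝ)..x, treeProb n b d y) ^ (n + 1) := by
  obtain ⟨a, ha⟩ : ∃ a : ℝ, a = n - 1 := ⟨_, rfl⟩
  have hn' : (2 : ℝ) ≤ n := by exact_mod_cast hn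
  have ha0 : 0 < a := by linarith
  -- The solution of the fixed-point equation on the unit interval; `|x|` makes it continuous on the
  -- whole line.
  set f : ℝ → ℝ := fun x => (1 + a * |x|) ^ (-(1 / a) - 1) with hf
  have hbase : ∀ x : ℝ, 1 ≤ 1 + a * |x| := fun x => by
    have := mul_nonneg ha0.le (abs_nonneg x); linarith
  have hexp : -(1 / a) - 1 ≤ 0 := by
    have : 0 < 1 / a := by positivity
    linarith
  have hc : Continuous f := by
    refine Continuous.rpow_const (by fun_prop) fun x => Or.inl ?_
    linarith [hbase x]
  have hfI : ∀ x ∈ Icc (0 : ℝ) 1, f x ∈ Icc (0 : ℝ) 1 := fun x _ =>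
    ⟨Real.rpow_nonneg (by linarith [hbase x]) _, Real.rpow_le_one_of_one_le_of_nonpos (hbase x) hexp⟩
  have hint : ∀ x ∈ Icc (0 : ℝ) 1, 1 - ∫ y in (0 : ℝ)..x, f y = (1 + a * |x|) ^ (-(1 / a)) := by
    intro x hx
    rw [hf, integral_one_add_mul_rpow ha0 (by positivity) hx.1, abs_of_nonneg hx.1,
      mul_one_div_cancel ha0.ne']
    ring
  have hpow : ∀ x ∈ Icc (0 : ℝ) 1, ∀ m : ℕ, (1 - ∫ y in (0 : ℝ)..x, f y) ^ m =
      (1 + a * |x|) ^ (-(1 / a) * m) := by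
    intro x hx m
    rw [hint x hx, ← Real.rpow_natCast, ← Real.rpow_mul (by linarith [hbase x])]
  have hfix : ∀ x ∈ Icc (0 : ℝ) 1, f x = (1 - ∫ y in (0 : ℝ)..x, f y) ^ n := by
    intro x hx
    rw [hpow x hx]
    simp only [hf]
    congr 1
    rw [show (n : ℝ) = a + 1 by linarith]
    field_simp
    ring
  have hmain := integral_treeProb_ge n hc hfI hfix b d (n + 1)
  have hval : ∫ x in (0 : ℝ)..1, (1 - ∫ y in (0 : ℝ)..x, f y) ^ (n + 1) =
      (1 - (n : ℝ) ^ (-(2 / ((n : ℝ) - 1)))) / 2 := by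
    -- Since `n + 1 = a + 2`, the exponent `-(n + 1) / a` is `-(2 / a) - 1`.
    rw [intervalIntegral.integral_congr (g := fun x => (1 + a * |x|) ^ (-(2 / a) - 1)) fun x hx => ?_]
    · rw [integral_one_add_mul_rpow ha0 (by positivity) zero_le_one,
        mul_div_cancel₀ _ ha0.ne', mul_one, ha, add_sub_cancel]
    · rw [uIcc_of_le zero_le_one] at hx
      simp only
      rw [hpow x hx]
      congr 1
      push_cast
      rw [show (n : ℝ) = a + 1 by linarith]
      field_simp
      ring
  rw [hval] at hmain
  push_cast at hmain
  exact hmain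

end Analysis

end GreedyIndep

/-! ### Choice of depth and conclusion -/

theorem mainTheorem8 (g r : ℕ) (hg : 4 ≤ g) (hr : 3 ≤ r)
    {V : Type*} [Fintype V] [Nonempty V] (G : SimpleGraph V) [DecidableRel G.Adj]
    (hreg : G.IsRegularOfDegree r) (hgirth : (g : ℕ∞) ≤ G.egirth) :
    (1 - ((r : ℝ) - 1) ^ (-(2 / ((r : ℝ) - 2)))) / 2
        - (r : ℝ) * ((r : ℝ) - 1) ^ ((g - 2) / 2) / (((g - 2) / 2 + 1)! : ℝ)
      ≤ (G.indepNum : ℝ) / (Fintype.card V : ℝ) := by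
  obtain ⟨n, rfl⟩ : ∃ n, r = n + 1 := ⟨r - 1, by omega⟩
  -- One less than `(g - 2) / 2`, because disjoint branches need `2 * d + 2 < g` strictly.
  obtain ⟨d, hd⟩ : ∃ d, (g - 2) / 2 = d + 1 := ⟨(g - 2) / 2 - 1, by omega⟩
  have hn : (2 : ℝ) ≤ n := by exact_mod_cast (by omega : 2 ≤ n)
  have hG : ((2 * d + 2 : ℕ) : ℕ∞) < G.egirth :=
    lt_of_lt_of_le (by exact_mod_cast (by omega)) hgirth
  have h1 := GreedyIndep.card_mul_le_indepNum hreg d hG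
  have h2 := GreedyIndep.integral_treeProb_ge_explicit (by omega : 2 ≤ n) true d
  have hV : (0 : ℝ) < Fintype.card V := by exact_mod_cast Fintype.card_pos
  rw [hd, le_div_iff₀ hV, mul_comm]
  refine (mul_le_mul_of_nonneg_left (le_trans ?_ h2) hV.le).trans h1
  push_cast
  rw [add_sub_cancel_right, show (n : ℝ) + 1 - 2 = n - 1 by ring]
  -- The error obtained has `n ^ d`, better than the required `n ^ (d + 1)` by a factor `n`.
  gcongr
  · linarith
  · omega
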